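/- \textbf{Setting.} For $q\in\mathbb{R}$, let $a_0(q)<a_1(q)<\cdots$ be the eigenvalues $a$ of the problem $\phi''(\eta)+(a-2q\cos 2\eta)\phi(\eta)=0$, $\phi$ even, $\phi(0)=\phi(2\pi)$, $\phi'(0)=\phi'(\pi)=0$, and let $b_1(q)<b_2(q)<\cdots$ be the eigenvalues for $\phi$ odd, $\phi(0)=\phi(2\pi)$, $\phi(0)=\phi(\pi)=0$. Let $\phi^+_n[q]=\mathrm{ce}_n(\cdot,q)$ ($n\ge 0$) and $\phi^-_n[q]=\mathrm{se}_n(\cdot,q)$ ($n\ge1$) be the corresponding real eigenfunctions, normalized by $$\int_0^{2\pi}\phi^\pm_n[q](\eta)^2\,d\eta=(1+\delta_{0,n})\pi$$ and by the signs $\mathrm{ce}_n(0,q)>0$, $\mathrm{se}_n'(0,q)>0$; they extend to entire functions. Put $\psi^+_n[q](\xi)=\mathrm{ce}_n(i\xi,q)$, $\psi^-_n[q](\xi)=-i\,\mathrm{se}_n(i\xi,q)$, and $\zeta^\pm_n[q](\xi,\eta)=\psi^\pm_n[q](\xi)\,\phi^\pm_n[q](\eta)$ for $q>0$. By convention $\phi^-_0$,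 $\psi^-_0$, $\zeta^-_0$ are identically zero. In elliptical coordinates $x=\cosh\xi\cos\eta$, $y=\sinh\xi\sin\eta$ the operator $D=\mathbf{i}\,\partial_x+\mathbf{j}\,\partial_y$ reads $$\mathcal{D}=\frac{2}{\cosh2\xi-\cos2\eta}\Big((\mathbf{i}\sinh\xi\cos\eta+\mathbf{j}\cosh\xi\sin\eta)\frac{\partial}{\partial\xi}+(\mathbf{j}\sinh\xi\cos\eta-\mathbf{i}\cosh\xi\sin\eta)\frac{\partial}{\partial\eta}\Big).$$ For $\lambda\ne0$ let $M^\pm_n[\lambda]=-\frac1\lambda(\mathcal{D}-\lambda)\,\zeta^\pm_n[\lambda^2/4]$, a quaternion-valued function with vanishing $\mathbf{k}$-component. For $0<\mu<1$ let $\xi_\mu>0$ be given by $\mu\cosh\xi_\mu=1$, let $R_{\xi_\mu}=[0,\xi_\mu)\times[0,2\pi]$, and let $q^\pm_{n,m}$ ($m\ge1$) be the $m$-th positive zero of $q\mapsto\psi^\pm_n[q](\xi_\mu)$. Put $\zeta^\pm_{n,m}[\mu]=\zeta^\pm_n[q^\pm_{n,m}]$ and $Z^\pm_{n,m}[\mu]=M^\pm_n\big[2\sqrt{q^\pm_{n,m}}\big]$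 (so that $Z^-_{0,m}[\mu]=0$ by convention). For quaternion-valued functions on $R_{\xi_\mu}$ consider the weighted inner product $$\langle f,g\rangle_{\xi_\mu}=\mathrm{Sc}\int_0^{2\pi}\!\!\int_0^{\xi_\mu}\overline{f(\xi,\eta)}\,g(\xi,\eta)\,\frac{\mu^2}{2}(\cosh2\xi-\cos2\eta)\,d\xi\,d\eta$$ with norm $\|f\|_{\xi_\mu}^2=\langle f,f\rangle_{\xi_\mu}$. \textbf{Theorem (Orthogonality).} Let $\mu\in(0,1)$. The functions $Z^+_{n,m}[\mu]$, $Z^-_{n,m}[\mu]$ ($n=0,1,\dots$, $m=1,2,\dots$) belong to the weighted space $L^2(R_{\xi_\mu})$, and any two of them with different indices $(\pm,n,m)$ are orthogonal with respect to $\langle\cdot,\cdot\rangle_{\xi_\mu}$. Their squared norms are, with $q=q^\pm_{n,m}$, \begin{align*} \|Z^\pm_{n,m}[\mu]\|^2_{\xi_\mu}=\;&\|\zeta^\pm_{n,m}[\mu]\|^2_{\xi_\mu}+\frac{\mu^2}{4q}(1+\delta_{0,n})\pi\int_0^{\xi_\mu}\big(\psi^\pm_n[q]'(\xi)\big)^2d\xi\\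 &+\frac{\mu^2}{4q}\Big(\int_0^{2\pi}\big(\phi^\pm_n[q]'(\eta)\big)^2d\eta\Big)\Big(\int_0^{\xi_\mu}\big(\psi^\pm_n[q](\xi)\big)^2d\xi\Big), \end{align*} where $$\|\zeta^\pm_{n,m}[\mu]\|^2_{\xi_\mu}=\int_0^{2\pi}\!\!\int_0^{\xi_\mu}\big(\zeta^\pm_{n,m}[\mu](\xi,\eta)\big)^2\,\frac{\mu^2}{2}(\cosh2\xi-\cos2\eta)\,d\xi\,d\eta,$$ and for the identically zero functions $Z^-_{0,m}[\mu]$ both sides are read as $0$. -/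

import Mathlib

open MeasureTheory
open scoped Quaternion

noncomputable section

namespace RQM

/-! ## Mathieu functions -/

/-- The superscript `±`: `plus` for the even family (`ce`, `Ce`), `minus` for the odd
family (`se`, `Se`). -/
inductive Sgn where
  | plus : Sgn
  | minus : Sgn

/-- `φ` is an entire solution of the Mathieu equation `φ'' + (a - 2 q cos 2z) φ = 0` which is
real on the real axis, even for the sign `+` and odd for the sign `-`.
(Every real solution on the line extends to an entire one; the extension is needed for the
modified functions `Ce(ξ) = ce(iξ)`, `Se(ξ) = -i se(iξ)`.) -/
def IsMathieuSolution (s : Sgn) (q a : ℝ) (φ : ℂ → ℂ) : Prop :=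
  Differentiable ℂ φ ∧
  (∀ z : ℂ, deriv (deriv φ) z + ((a : ℂ) - 2 * (q : ℂ) * Complex.cos (2 * z)) * φ z = 0) ∧
  (∀ x : ℝ, (φ (x : ℂ)).im = 0) ∧
  (match s with
    | Sgn.plus => ∀ z : ℂ, φ (-z) = φ z
    | Sgn.minus => ∀ z : ℂ, φ (-z) = -φ z)

/-- The boundary conditions `φ(0) = φ(2π)`, `φ'(0) = φ'(π) = 0` (sign `+`), respectively
`φ(0) = φ(2π)`, `φ(0) = φ(π) = 0` (sign `-`). -/
def MathieuBoundary (s : Sgn) (φ : ℂ → ℂ) : Prop :=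
  φ 0 = φ (2 * (Real.pi : ℂ)) ∧
  (match s with
    | Sgn.plus => deriv φ 0 = 0 ∧ deriv φ (Real.pi : ℂ) = 0
    | Sgn.minus => φ 0 = 0 ∧ φ (Real.pi : ℂ) = 0)

/-- `φ` is an eigenfunction of the Mathieu boundary value problem with eigenvalue `a`. -/
def IsMathieuEigenfunction (s : Sgn) (q a : ℝ) (φ : ℂ → ℂ) : Prop :=
  IsMathieuSolution s q a φ ∧ MathieuBoundary s φ ∧ φ ≠ 0

/-- The set of eigenvalues of the Mathieu boundary value problem. -/
def mathieuEigenvalues (s : Sgn) (q : ℝ) : Set ℝ :=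
  {a | ∃ φ : ℂ → ℂ, IsMathieuEigenfunction s q a φ}

/-- `a` is the Mathieu characteristic `a_n(q)` (sign `+`) or `b_n(q)` (sign `-`), where the
eigenvalues are listed increasingly as `a_0 < a_1 < ...` and `b_1 < b_2 < ...`.
There is no `b_0`, so the condition fails for the sign `-` and `n = 0`. -/
def IsMathieuCharacteristic (s : Sgn) (n : ℕ) (q a : ℝ) : Prop :=
  a ∈ mathieuEigenvalues s q ∧
  (match s with
    | Sgn.plus => {b | b ∈ mathieuEigenvalues s q ∧ b < a}.encard = (n : ℕ∞)
    | Sgn.minus => {b | b ∈ mathieuEigenvalues s q ∧ b < a}.encard + 1 = (n : ℕ∞))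

/-- `φ` is the Mathieu function `ce_n(·, q)` (sign `+`) or `se_n(·, q)` (sign `-`), with the
normalization `∫₀^{2π} φ² = π`, except `∫₀^{2π} φ² = 2π` for `n = 0`, and with the usual choice
of the factor `±1` by `ce_n(0, q) > 0`, `se_n'(0, q) > 0`. -/
def IsMathieuFunction (s : Sgn) (n : ℕ) (q : ℝ) (φ : ℂ → ℂ) : Prop :=
  (∃ a : ℝ, IsMathieuCharacteristic s n q a ∧ IsMathieuEigenfunction s q a φ) ∧
  (∫ η in (0 : ℝ)..(2 * Real.pi), (φ (η : ℂ)).re ^ 2) =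
    (1 + if n = 0 then 1 else 0) * Real.pi ∧
  (match s with
    | Sgn.plus => 0 < (φ 0).re
    | Sgn.minus => 0 < (deriv φ 0).re)

open Classical in
/-- The Mathieu functions `ce_n(·, q)`, `se_n(·, q)` as entire functions; `se_0 = 0`. -/
def mathieuFun (s : Sgn) (n : ℕ) (q : ℝ) : ℂ → ℂ :=
  if h : ∃ φ : ℂ → ℂ, IsMathieuFunction s n q φ then h.choose else 0

/-- The angular functions `φ^+_n[q] = ce_n(·, q)`, `φ^-_n[q] = se_n(·, q)`. -/
def angular (s : Sgn) (n : ℕ) (q : ℝ) (η : ℝ) : ℝ :=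
  (mathieuFun s n q (η : ℂ)).re

/-- The radial functions `ψ^+_n[q](ξ) = ce_n(iξ, q)`, `ψ^-_n[q](ξ) = -i se_n(iξ, q)`
(these numbers are real). -/
def radial (s : Sgn) (n : ℕ) (q : ℝ) (ξ : ℝ) : ℝ :=
  match s with
    | Sgn.plus => (mathieuFun Sgn.plus n q (Complex.I * (ξ : ℂ))).re
    | Sgn.minus => (-Complex.I * mathieuFun Sgn.minus n q (Complex.I * (ξ : ℂ))).re

open Classical in
/-- The two-dimensional Mathieu functions `ζ^±_n[q](ξ, η) = ψ^±_n[q](ξ) φ^±_n[q](η)`, which are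
considered for `q > 0` only (the value for `q ≤ 0` is a dummy). -/
def zeta (s : Sgn) (n : ℕ) (q : ℝ) (p : ℝ × ℝ) : ℝ :=
  if 0 < q then radial s n q p.1 * angular s n q p.2 else 0

/-! ## Reduced quaternionic Mathieu functions -/

/-- The quaternion unit `i`. -/
def qi : ℍ[ℝ] := ⟨0, 1, 0, 0⟩

/-- The quaternion unit `j`. -/
def qj : ℍ[ℝ] := ⟨0, 0, 1, 0⟩

/-- The operator `D = i ∂/∂x + j ∂/∂y` in the elliptical coordinates
`x = cosh ξ cos η`, `y = sinh ξ sin η`; a point is `p = (ξ, η)`. -/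
def ellD (f : ℝ × ℝ → ℍ[ℝ]) (p : ℝ × ℝ) : ℍ[ℝ] :=
  (2 / (Real.cosh (2 * p.1) - Real.cos (2 * p.2))) •
    (((Real.sinh p.1 * Real.cos p.2) • qi + (Real.cosh p.1 * Real.sin p.2) • qj) *
        deriv (fun ξ : ℝ => f (ξ, p.2)) p.1 +
      ((Real.sinh p.1 * Real.cos p.2) • qj - (Real.cosh p.1 * Real.sin p.2) • qi) *
        deriv (fun η : ℝ => f (p.1, η)) p.2)

/-- The `l`-reduced quaternionic Mathieu functions
`M^±_n[l] = -(1/l) (D - l) ζ^±_n[l²/4]`. -/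
def rqm (s : Sgn) (n : ℕ) (l : ℝ) (p : ℝ × ℝ) : ℍ[ℝ] :=
  (-(1 / l)) • (ellD (fun x => (zeta s n (l ^ 2 / 4) x : ℍ[ℝ])) p -
    l • (zeta s n (l ^ 2 / 4) p : ℍ[ℝ]))

/-! ## Zero-boundary functions -/

/-- The number `ξ_μ ≥ 0` with `μ cosh ξ_μ = 1`. -/
def xiMu (μ : ℝ) : ℝ := Real.arcosh (1 / μ)

theorem mul_cosh_xiMu {μ : ℝ} (h0 : 0 < μ) (h1 : μ < 1) :
    0 < xiMu μ ∧ μ * Real.cosh (xiMu μ) = 1 := by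
  have h : 1 < 1 / μ := by rw [lt_div_iff₀ h0]; linarith
  refine ⟨Real.arcosh_pos h, ?_⟩
  unfold xiMu
  rw [Real.cosh_arcosh h.le]
  field_simp

/-- `q` is the `m`-th positive zero (`m = 1, 2, ...`) of the function `q ↦ ψ^±_n[q](ξ)`. -/
def IsRadialZero (s : Sgn) (n m : ℕ) (ξ q : ℝ) : Prop :=
  0 < q ∧ radial s n q ξ = 0 ∧
  {r : ℝ | 0 < r ∧ r < q ∧ radial s n r ξ = 0}.encard + 1 = (m : ℕ∞)

open Classical in
/-- `q^±_{n,m}(ξ)`, the `m`-th positive zero of `q ↦ ψ^±_n[q](ξ)`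
(for the identically zero function `ψ^-_0` the value is a dummy). -/
def qZero (s : Sgn) (n m : ℕ) (ξ : ℝ) : ℝ :=
  if h : ∃ q : ℝ, IsRadialZero s n m ξ q then h.choose else 0

/-- `ζ^±_{n,m}[μ] = ζ^±_n[q^±_{n,m}(ξ_μ)]`. -/
def zetaZ (s : Sgn) (n m : ℕ) (μ : ℝ) : ℝ × ℝ → ℝ :=
  zeta s n (qZero s n m (xiMu μ))

/-- The zero-boundary RQM-functions `Z^±_{n,m}[μ] = M^±_n[2 √(q^±_{n,m}(ξ_μ))]`. -/
def zeroRQM (s : Sgn) (n m : ℕ) (μ : ℝ) : ℝ × ℝ → ℍ[ℝ] :=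
  rqm s n (2 * √(qZero s n m (xiMu μ)))

/-! ## The weighted `L²` inner product -/

/-- The rectangle `R_{ξ₀} = [0, ξ₀) × [0, 2π]`. -/
def ellRect (ξ₀ : ℝ) : Set (ℝ × ℝ) := Set.Ico 0 ξ₀ ×ˢ Set.Icc 0 (2 * Real.pi)

/-- The weight `(μ²/2) (cosh 2ξ - cos 2η)`, the area density of the rescaled ellipse
`μ Ω_{ξ_μ}` in the coordinates `(ξ, η)`. -/
def ellWeight (μ : ℝ) (p : ℝ × ℝ) : ℝ :=
  μ ^ 2 / 2 * (Real.cosh (2 * p.1) - Real.cos (2 * p.2))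

/-- Membership in the weighted space `L²(R_{ξ_μ})` of quaternion-valued functions. -/
def MemWeightedL2 (μ : ℝ) (f : ℝ × ℝ → ℍ[ℝ]) : Prop :=
  AEStronglyMeasurable f (volume.restrict (ellRect (xiMu μ))) ∧
  IntegrableOn (fun p => ‖f p‖ ^ 2 * ellWeight μ p) (ellRect (xiMu μ)) volume

/-- The weighted inner product `Sc ∫∫ conj(f) g (μ²/2) (cosh 2ξ - cos 2η) dξ dη` over
`R_{ξ_μ}`. -/
def ellInner (μ : ℝ) (f g : ℝ × ℝ → ℍ[ℝ]) : ℝ :=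
  ∫ p in ellRect (xiMu μ), (star (f p) * g p).re * ellWeight μ p

end RQM

end

/-! ### Linear uniqueness and separated solutions. -/

namespace RQM

/-! For `ζ = ψ φ`, the function `M = ζ - λ⁻¹ Dζ` has scalar part `ζ` and vector part `-λ⁻¹ ∇ζ`, so
`Sc (conj M₁ M₂) = ζ₁ ζ₂ + ∇ζ₁·∇ζ₂ / (λ₁ λ₂)`. In elliptical coordinates the area weight cancels the
conformal factor of the gradient term, and every integral becomes a combination of products of
one-dimensional integrals (`re_star_separatedRQM_mul`, `ellInner_eq`). With equal indices this is
already the norm formula.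

For orthogonality within one sign, Green's identity in each variable makes `∫ ∇ζ₁·∇ζ₂` a multiple of
`∫ ζ₁ ζ₂`; the symmetry of both sides then forces `∫ ζ₁ ζ₂ = 0` unless both `q` and `a` agree
(`orthogonal_of_ne`). If they agree, `a` determines `n`, and `q` then determines `m`. For opposite
signs the angular integrands are odd about `π` (`integral_ang_of_ne`).

Existence of Mathieu functions or of radial zeros plays no role: where a choice has no candidate,
the default values make all functions involved vanish (`zeroRQM_cases`). -/

/-- A solution of `u'' = -p u` with bounded `p` and `u(t₀) = u'(t₀) = 0` vanishes. -/
theorem eq_zero_of_linear_ode {p u u' : ℝ → ℝ} {K t₀ : ℝ} (hp : ∀ x, |p x| ≤ K)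
    (hu : ∀ x, HasDerivAt u (u' x) x) (hu' : ∀ x, HasDerivAt u' (-p x * u x) x)
    (h0 : u t₀ = 0) (h1 : u' t₀ = 0) (x : ℝ) : u x = 0 := by
  have hK : 0 ≤ K := (abs_nonneg _).trans (hp 0)
  -- The pair `(u, u')` solves a first-order system, Lipschitz in the state with constant `max 1 K`,
  -- as does the zero function.
  have key := ODE_solution_unique_univ (v := fun t (y : ℝ × ℝ) => (y.2, -p t * y.1))
    (s := fun _ => Set.univ) (K := ⟨max 1 K, by positivity⟩) (t₀ := t₀)
    (f := fun t => (u t, u' t)) (g := fun _ => 0) ?_ ?_ ?_ ?_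
  · exact congrArg Prod.fst (congrFun key x)
  · intro t
    refine LipschitzOnWith.of_dist_le_mul fun y _ z _ => ?_
    rw [Prod.dist_eq, Prod.dist_eq]
    change max (dist y.2 z.2) (dist (-p t * y.1) (-p t * z.1)) ≤
      max 1 K * max (dist y.1 z.1) (dist y.2 z.2)
    refine max_le ?_ ?_
    · calc dist y.2 z.2 = 1 * dist y.2 z.2 := (one_mul _).symm
        _ ≤ _ := mul_le_mul (le_max_left _ _) (le_max_right _ _) dist_nonneg (by positivity)
    · have : dist (-p t * y.1) (-p t * z.1) = |p t| * dist y.1 z.1 := by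
        rw [Real.dist_eq, Real.dist_eq, ← mul_sub, abs_mul, abs_neg]
      rw [this]
      exact mul_le_mul ((hp t).trans (le_max_right _ _)) (le_max_left _ _) dist_nonneg
        (by positivity)
  · exact fun t => ⟨(hu t).prodMk (hu' t), trivial⟩
  · intro t
    refine ⟨?_, trivial⟩
    have := hasDerivAt_const t (0 : ℝ × ℝ)
    convert this using 1
    simp
  · simp [h0, h1]

/-- The sign `ε = ±1` of a family under reflection. -/
def Sgn.parity : Sgn → ℝ
  | plus => 1
  | minus => -1

/-- The real data of a separated solution `ψ(ξ) φ(η)`: the two ordinary differential equations,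
the boundary conditions at `0` and the parity of `φ` about `π`. -/
structure IsSeparated (s : Sgn) (q a : ℝ) (φ φ' ψ ψ' : ℝ → ℝ) : Prop where
  hasDerivAt_ang : ∀ x, HasDerivAt φ (φ' x) x
  hasDerivAt_ang' : ∀ x, HasDerivAt φ' (-(a - 2 * q * Real.cos (2 * x)) * φ x) x
  hasDerivAt_rad : ∀ x, HasDerivAt ψ (ψ' x) x
  hasDerivAt_rad' : ∀ x, HasDerivAt ψ' ((a - 2 * q * Real.cosh (2 * x)) * ψ x) x
  reflect : ∀ x, φ (2 * Real.pi - x) = s.parity * φ x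
  boundary : match s with
    | Sgn.plus => φ' 0 = 0 ∧ ψ' 0 = 0
    | Sgn.minus => φ 0 = 0 ∧ ψ 0 = 0

namespace IsSeparated

variable {s : Sgn} {q a : ℝ} {φ φ' ψ ψ' : ℝ → ℝ}

theorem continuous_ang (h : IsSeparated s q a φ φ' ψ ψ') : Continuous φ :=
  continuous_iff_continuousAt.2 fun x => (h.hasDerivAt_ang x).continuousAt

theorem continuous_ang' (h : IsSeparated s q a φ φ' ψ ψ') : Continuous φ' :=
  continuous_iff_continuousAt.2 fun x => (h.hasDerivAt_ang' x).continuousAt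

theorem continuous_rad (h : IsSeparated s q a φ φ' ψ ψ') : Continuous ψ :=
  continuous_iff_continuousAt.2 fun x => (h.hasDerivAt_rad x).continuousAt

theorem continuous_rad' (h : IsSeparated s q a φ φ' ψ ψ') : Continuous ψ' :=
  continuous_iff_continuousAt.2 fun x => (h.hasDerivAt_rad' x).continuousAt

theorem reflect' (h : IsSeparated s q a φ φ' ψ ψ') (x : ℝ) :
    φ' (2 * Real.pi - x) = -s.parity * φ' x := by
  have h1 : HasDerivAt (fun x => φ (2 * Real.pi - x)) (-φ' (2 * Real.pi - x)) x := by
    simpa using (h.hasDerivAt_ang (2 * Real.pi - x)).comp_const_sub (2 * Real.pi) x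
  have h2 : HasDerivAt (fun x => φ (2 * Real.pi - x)) (s.parity * φ' x) x := by
    simp_rw [h.reflect]
    exact (h.hasDerivAt_ang x).const_mul _
  linarith [h1.unique h2]

end IsSeparated

/-! ### Green's identities and orthogonality of separated solutions. -/

/-- Green's identity on an interval, for a product `u v'` with vanishing boundary terms. -/
theorem integral_deriv_mul_deriv {u u' v v' r : ℝ → ℝ} {b : ℝ}
    (hu : ∀ x, HasDerivAt u (u' x) x) (hv : ∀ x, HasDerivAt v (v' x) x)
    (hv' : ∀ x, HasDerivAt v' (r x * v x) x) (hr : Continuous r) (hu' : Continuous u')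
    (h0 : u 0 * v' 0 = 0) (hb : u b * v' b = 0) :
    (∫ x in (0 : ℝ)..b, u' x * v' x) = -∫ x in (0 : ℝ)..b, r x * (u x * v x) := by
  have cu : Continuous u := continuous_iff_continuousAt.2 fun x => (hu x).continuousAt
  have cv : Continuous v := continuous_iff_continuousAt.2 fun x => (hv x).continuousAt
  have cv' : Continuous v' := continuous_iff_continuousAt.2 fun x => (hv' x).continuousAt
  have := intervalIntegral.integral_deriv_mul_eq_sub (a := 0) (b := b) (u := u) (v := v')
    (u' := u') (v' := fun x => r x * v x) (fun x _ => hu x) (fun x _ => hv' x)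
    (hu'.intervalIntegrable _ _) ((hr.mul cv).intervalIntegrable _ _)
  rw [h0, hb, intervalIntegral.integral_add
    (Continuous.intervalIntegrable (by fun_prop) _ _)
    (Continuous.intervalIntegrable (by fun_prop) _ _)] at this
  have e : (∫ x in (0 : ℝ)..b, r x * (u x * v x)) = ∫ x in (0 : ℝ)..b, u x * (r x * v x) :=
    intervalIntegral.integral_congr fun x _ => by ring
  rw [e]
  linarith

theorem integral_affine_mul {k f : ℝ → ℝ} (hk : Continuous k) (hf : Continuous f) (a q b : ℝ) :
    (∫ x in (0 : ℝ)..b, (a - 2 * q * k x) * f x) =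
      a * (∫ x in (0 : ℝ)..b, f x) - 2 * q * ∫ x in (0 : ℝ)..b, f x * k x := by
  rw [← intervalIntegral.integral_const_mul, ← intervalIntegral.integral_const_mul,
    ← intervalIntegral.integral_sub (Continuous.intervalIntegrable (by fun_prop) _ _)
      (Continuous.intervalIntegrable (by fun_prop) _ _)]
  exact intervalIntegral.integral_congr fun x _ => by ring

theorem integral_eq_zero_of_reflect {f : ℝ → ℝ} {b : ℝ} (h : ∀ x, f (b - x) = -f x) :
    (∫ x in (0 : ℝ)..b, f x) = 0 := by
  have := intervalIntegral.integral_comp_sub_left (a := 0) (b := b) f b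
  simp only [h, sub_self, sub_zero, intervalIntegral.integral_neg] at this
  linarith

theorem cos_reflect (x : ℝ) : Real.cos (2 * (2 * Real.pi - x)) = Real.cos (2 * x) := by
  rw [show 2 * (2 * Real.pi - x) = (2 : ℕ) * (2 * Real.pi) - 2 * x by push_cast; ring,
    Real.cos_nat_mul_two_pi_sub]

namespace IsSeparated

variable {s t : Sgn} {q₁ q₂ a₁ a₂ ξ₀ : ℝ} {φ₁ φ₁' ψ₁ ψ₁' φ₂ φ₂' ψ₂ ψ₂' : ℝ → ℝ}

/-- These are the boundary terms in Green's identity: at `0` one factor vanishes by the boundary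
conditions of the family, and reflection about `π` carries this to `2π`. The radial end `ξ₀` is left
to the Dirichlet condition. -/
theorem ang_mul_deriv_zero (h₁ : IsSeparated s q₁ a₁ φ₁ φ₁' ψ₁ ψ₁')
    (h₂ : IsSeparated s q₂ a₂ φ₂ φ₂' ψ₂ ψ₂') :
    φ₁ 0 * φ₂' 0 = 0 ∧ φ₁ (2 * Real.pi) * φ₂' (2 * Real.pi) = 0 ∧ ψ₁ 0 * ψ₂' 0 = 0 := by
  have r1 := h₁.reflect 0
  have r2 := h₂.reflect' 0
  have b1 := h₁.boundary
  have b2 := h₂.boundary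
  rw [sub_zero] at r1 r2
  cases s <;> simp_all

theorem integral_ang' (h₁ : IsSeparated s q₁ a₁ φ₁ φ₁' ψ₁ ψ₁')
    (h₂ : IsSeparated s q₂ a₂ φ₂ φ₂' ψ₂ ψ₂') :
    (∫ x in (0 : ℝ)..(2 * Real.pi), φ₁' x * φ₂' x) =
      a₂ * (∫ x in (0 : ℝ)..(2 * Real.pi), φ₁ x * φ₂ x) -
        2 * q₂ * ∫ x in (0 : ℝ)..(2 * Real.pi), φ₁ x * φ₂ x * Real.cos (2 * x) := by
  have hb := h₁.ang_mul_deriv_zero h₂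
  have c1 := h₁.continuous_ang
  have c2 := h₂.continuous_ang
  rw [integral_deriv_mul_deriv h₁.hasDerivAt_ang h₂.hasDerivAt_ang h₂.hasDerivAt_ang'
    (by fun_prop) h₁.continuous_ang' hb.1 hb.2.1,
    ← integral_affine_mul (f := fun x => φ₁ x * φ₂ x) (by fun_prop) (by fun_prop), ← intervalIntegral.integral_neg]
  exact intervalIntegral.integral_congr fun x _ => by ring

theorem integral_rad' (h₁ : IsSeparated s q₁ a₁ φ₁ φ₁' ψ₁ ψ₁')
    (h₂ : IsSeparated s q₂ a₂ φ₂ φ₂' ψ₂ ψ₂') (h0 : ψ₁ ξ₀ = 0) :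
    (∫ x in (0 : ℝ)..ξ₀, ψ₁' x * ψ₂' x) =
      -(a₂ * (∫ x in (0 : ℝ)..ξ₀, ψ₁ x * ψ₂ x) -
        2 * q₂ * ∫ x in (0 : ℝ)..ξ₀, ψ₁ x * ψ₂ x * Real.cosh (2 * x)) := by
  have hb := h₁.ang_mul_deriv_zero h₂
  have c1 := h₁.continuous_rad
  have c2 := h₂.continuous_rad
  rw [integral_deriv_mul_deriv h₁.hasDerivAt_rad h₂.hasDerivAt_rad h₂.hasDerivAt_rad'
    (by fun_prop) h₁.continuous_rad' hb.2.2 (by rw [h0, zero_mul]),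
    ← integral_affine_mul (f := fun x => ψ₁ x * ψ₂ x) (by fun_prop) (by fun_prop)]

/-- Orthogonality of two separated solutions of the same parity, in `L²` and for the gradients. -/
theorem orthogonal_of_ne (h₁ : IsSeparated s q₁ a₁ φ₁ φ₁' ψ₁ ψ₁')
    (h₂ : IsSeparated s q₂ a₂ φ₂ φ₂' ψ₂ ψ₂') (z₁ : ψ₁ ξ₀ = 0) (z₂ : ψ₂ ξ₀ = 0)
    (hne : q₁ = q₂ → a₁ ≠ a₂) :
    (∫ x in (0 : ℝ)..ξ₀, ψ₁ x * ψ₂ x * Real.cosh (2 * x)) *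
        (∫ x in (0 : ℝ)..(2 * Real.pi), φ₁ x * φ₂ x) -
      (∫ x in (0 : ℝ)..ξ₀, ψ₁ x * ψ₂ x) *
        (∫ x in (0 : ℝ)..(2 * Real.pi), φ₁ x * φ₂ x * Real.cos (2 * x)) = 0 ∧
    (∫ x in (0 : ℝ)..ξ₀, ψ₁' x * ψ₂' x) * (∫ x in (0 : ℝ)..(2 * Real.pi), φ₁ x * φ₂ x) +
      (∫ x in (0 : ℝ)..ξ₀, ψ₁ x * ψ₂ x) *
        (∫ x in (0 : ℝ)..(2 * Real.pi), φ₁' x * φ₂' x) = 0 := by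
  have i1 := h₁.integral_ang' h₂
  have i2 := h₂.integral_ang' h₁
  have j1 := h₁.integral_rad' h₂ z₁
  have j2 := h₂.integral_rad' h₁ z₂
  -- Green's identity with the roles exchanged has the same left-hand side, which yields two linear
  -- relations among the four integrals `A`, `B`, `C`, `E`.
  simp_rw [mul_comm (φ₂' _), mul_comm (φ₂ _)] at i2
  simp_rw [mul_comm (ψ₂' _), mul_comm (ψ₂ _)] at j2
  rw [i1] at i2
  rw [j1] at j2
  rw [i1, j1]
  set A := ∫ x in (0 : ℝ)..(2 * Real.pi), φ₁ x * φ₂ x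
  set B := ∫ x in (0 : ℝ)..(2 * Real.pi), φ₁ x * φ₂ x * Real.cos (2 * x)
  set C := ∫ x in (0 : ℝ)..ξ₀, ψ₁ x * ψ₂ x
  set E := ∫ x in (0 : ℝ)..ξ₀, ψ₁ x * ψ₂ x * Real.cosh (2 * x)
  have key : E * A - C * B = 0 := by
    by_cases hq : q₁ = q₂
    · subst hq
      have ha : a₁ - a₂ ≠ 0 := sub_ne_zero.2 (hne rfl)
      have hA : A = 0 := by
        have : (a₁ - a₂) * A = 0 := by linarith
        simpa [ha] using this
      have hC : C = 0 := by
        have : (a₁ - a₂) * C = 0 := by linarith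
        simpa [ha] using this
      rw [hA, hC]
      ring
    -- Multiplying the radial relation by `A` and the angular one by `C` eliminates `a₁ - a₂`.
    · have : (q₁ - q₂) * (E * A - C * B) = 0 := by
        linear_combination (-1 / 2) * A * j2 - (1 / 2) * C * i2
      simpa [sub_ne_zero.2 hq] using this
  refine ⟨key, ?_⟩
  -- In the gradient integral the `a₂` terms cancel, leaving `2 q₂ (E A - C B)`.
  linear_combination 2 * q₂ * key

/-- The angular integrals of two separated solutions of different parity vanish. -/
theorem integral_ang_of_ne (h₁ : IsSeparated s q₁ a₁ φ₁ φ₁' ψ₁ ψ₁')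
    (h₂ : IsSeparated t q₂ a₂ φ₂ φ₂' ψ₂ ψ₂') (hst : s ≠ t) :
    (∫ x in (0 : ℝ)..(2 * Real.pi), φ₁ x * φ₂ x) = 0 ∧
    (∫ x in (0 : ℝ)..(2 * Real.pi), φ₁ x * φ₂ x * Real.cos (2 * x)) = 0 ∧
    (∫ x in (0 : ℝ)..(2 * Real.pi), φ₁' x * φ₂' x) = 0 := by
  have hp : s.parity * t.parity = -1 := by
    cases s <;> cases t <;> simp_all [Sgn.parity]
  refine ⟨?_, ?_, ?_⟩ <;> refine integral_eq_zero_of_reflect fun x => ?_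
  · rw [h₁.reflect, h₂.reflect]
    linear_combination φ₁ x * φ₂ x * hp
  · rw [h₁.reflect, h₂.reflect, cos_reflect]
    linear_combination φ₁ x * φ₂ x * Real.cos (2 * x) * hp
  · rw [h₁.reflect', h₂.reflect']
    linear_combination φ₁' x * φ₂' x * hp

end IsSeparated

/-! ### From entire Mathieu functions to real separated data. -/

/-- The restriction of an entire Mathieu solution to a line through the origin. -/
theorem hasDerivAt_re_comp {f : ℂ → ℂ} (hf : Differentiable ℂ f) (c d : ℂ) (x : ℝ) :
    HasDerivAt (fun x : ℝ => (c * f (d * x)).re) ((c * (d * deriv f (d * x))).re) x := by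
  have h1 : HasDerivAt (fun z : ℂ => c * f (d * z)) (c * (d * deriv f (d * x))) (x : ℂ) := by
    have := ((hf (d * x)).hasDerivAt.comp (x : ℂ)
      ((hasDerivAt_id (x : ℂ)).const_mul d)).const_mul c
    exact this.congr_deriv (by ring)
  exact h1.real_of_complex

/-- The radial data of `φ` along the imaginary axis, and its angular data along the real axis. -/
theorem IsMathieuEigenfunction.isSeparated {s : Sgn} {q a : ℝ} {f : ℂ → ℂ}
    (h : IsMathieuEigenfunction s q a f) :
    ∃ φ' ψ' : ℝ → ℝ, IsSeparated s q a (fun η => (f η).re) φ'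
      (fun ξ => match s with
        | Sgn.plus => (f (Complex.I * ξ)).re
        | Sgn.minus => (-Complex.I * f (Complex.I * ξ)).re) ψ' := by
  obtain ⟨⟨hd, hode, hreal, -⟩, ⟨-, hb⟩, -⟩ := h
  have hd' : Differentiable ℂ (deriv f) := fun z =>
    ((hd.differentiableOn (s := Set.univ)).deriv isOpen_univ).differentiableAt Filter.univ_mem
  have hode' (z : ℂ) : deriv (deriv f) z =
      -(((a : ℂ) - 2 * (q : ℂ) * Complex.cos (2 * z)) * f z) := eq_neg_of_add_eq_zero_left (hode z)
  have A1 (x : ℝ) : HasDerivAt (fun x : ℝ => (f x).re) (deriv f x).re x := by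
    simpa using hasDerivAt_re_comp hd 1 1 x
  have A2 (x : ℝ) : HasDerivAt (fun x : ℝ => (deriv f x).re)
      (-(a - 2 * q * Real.cos (2 * x)) * (f x).re) x := by
    have := hasDerivAt_re_comp hd' 1 1 x
    simp only [one_mul] at this
    convert this using 1
    rw [hode', show (a : ℂ) - 2 * q * Complex.cos (2 * x) =
      ((a - 2 * q * Real.cos (2 * x) : ℝ) : ℂ) by push_cast; ring, Complex.neg_re,
      Complex.re_ofReal_mul, neg_mul]
  have B1 (c : ℂ) (x : ℝ) := hasDerivAt_re_comp hd c Complex.I x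
  have B2 (c : ℂ) (x : ℝ) :
      HasDerivAt (fun x : ℝ => (c * (Complex.I * deriv f (Complex.I * x))).re)
        ((a - 2 * q * Real.cosh (2 * x)) * (c * f (Complex.I * x)).re) x := by
    have := hasDerivAt_re_comp hd' (c * Complex.I) Complex.I x
    simp only [mul_assoc] at this
    convert this using 1
    -- Along the imaginary axis `cos` becomes `cosh`, and the factor `i² = -1` from differentiating
    -- twice reverses the sign of the equation.
    rw [hode', show 2 * (Complex.I * x) = ((2 * x : ℝ) : ℂ) * Complex.I by push_cast; ring,
      Complex.cos_mul_I, show (a : ℂ) - 2 * q * Complex.cosh ((2 * x : ℝ) : ℂ) =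
      ((a - 2 * q * Real.cosh (2 * x) : ℝ) : ℂ) by push_cast; ring,
      ← Complex.re_ofReal_mul]
    congr 1
    linear_combination (c * (((a - 2 * q * Real.cosh (2 * x) : ℝ) : ℂ)) *
      f (Complex.I * x)) * Complex.I_mul_I
  -- The coefficient is symmetric about `π`, so `φ(2π - x) - ε φ(x)` solves the same equation; the
  -- boundary condition at `π` makes its value and derivative vanish there.
  have hrefl (x : ℝ) : (f ((2 * Real.pi - x : ℝ) : ℂ)).re = s.parity * (f x).re := by
    have hK : ∀ x : ℝ, |a - 2 * q * Real.cos (2 * x)| ≤ |a| + 2 * |q| := fun x => by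
      calc |a - 2 * q * Real.cos (2 * x)| ≤ |a| + |2 * q * Real.cos (2 * x)| := abs_sub _ _
        _ ≤ |a| + 2 * |q| := by
          rw [abs_mul, abs_mul, abs_two]
          nlinarith [Real.abs_cos_le_one (2 * x), abs_nonneg q]
    have C1 (x : ℝ) : HasDerivAt (fun x : ℝ => (f ((2 * Real.pi - x : ℝ) : ℂ)).re)
        (-(deriv f ((2 * Real.pi - x : ℝ) : ℂ)).re) x :=
      (A1 (2 * Real.pi - x)).comp_const_sub (2 * Real.pi) x
    have C2 (x : ℝ) : HasDerivAt (fun x : ℝ => -(deriv f ((2 * Real.pi - x : ℝ) : ℂ)).re)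
        (-(a - 2 * q * Real.cos (2 * x)) * (f ((2 * Real.pi - x : ℝ) : ℂ)).re) x := by
      have := ((A2 (2 * Real.pi - x)).comp_const_sub (2 * Real.pi) x).fun_neg
      rwa [cos_reflect, neg_neg] at this
    have epi : 2 * Real.pi - Real.pi = Real.pi := by ring
    have := eq_zero_of_linear_ode (t₀ := Real.pi) hK
      (fun x => (C1 x).fun_sub ((A1 x).const_mul s.parity))
      (fun x => ((C2 x).fun_sub ((A2 x).const_mul s.parity)).congr_deriv (by ring)) ?_ ?_ x
    · linarith
    · rw [epi]
      cases s <;> simp [Sgn.parity, hb.2]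
    · rw [epi]
      cases s <;> simp [Sgn.parity, hb.2]
  cases s with
  | plus =>
    refine ⟨_, _, A1, A2, fun x => by simpa using B1 1 x, fun x => by simpa using B2 1 x,
      hrefl, ?_⟩
    simp [hb.1]
  | minus =>
    refine ⟨_, _, A1, A2, B1 _, B2 _, hrefl, ?_⟩
    simp [hb.1]

/-! ### Pointwise form of the RQM functions. -/

@[simp] theorem re_qi : qi.re = 0 := rfl
@[simp] theorem imI_qi : qi.imI = 1 := rfl
@[simp] theorem imJ_qi : qi.imJ = 0 := rfl
@[simp] theorem imK_qi : qi.imK = 0 := rfl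
@[simp] theorem re_qj : qj.re = 0 := rfl
@[simp] theorem imI_qj : qj.imI = 0 := rfl
@[simp] theorem imJ_qj : qj.imJ = 1 := rfl
@[simp] theorem imK_qj : qj.imK = 0 := rfl

/-- The separated form of `M^±_n[l]` at a point, in terms of the values of a product `ψ φ` and
its two partial derivatives. -/
noncomputable def separatedRQM (l : ℝ) (φ φ' ψ ψ' : ℝ → ℝ) (p : ℝ × ℝ) : ℍ[ℝ] :=
  (ψ p.1 * φ p.2) • (1 : ℍ[ℝ]) -
    (2 / (l * (Real.cosh (2 * p.1) - Real.cos (2 * p.2)))) •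
      ((Real.sinh p.1 * Real.cos p.2 * (ψ' p.1 * φ p.2) -
          Real.cosh p.1 * Real.sin p.2 * (ψ p.1 * φ' p.2)) • qi +
        (Real.cosh p.1 * Real.sin p.2 * (ψ' p.1 * φ p.2) +
          Real.sinh p.1 * Real.cos p.2 * (ψ p.1 * φ' p.2)) • qj)

theorem hasDerivAt_quaternion_coe {f : ℝ → ℝ} {f' x : ℝ} (hf : HasDerivAt f f' x) :
    HasDerivAt (fun x => (f x : ℍ[ℝ])) (f' : ℍ[ℝ]) x := by
  have := hf.smul_const (1 : ℍ[ℝ])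
  have e (r : ℝ) : r • (1 : ℍ[ℝ]) = (r : ℍ[ℝ]) := (Algebra.algebraMap_eq_smul_one r).symm
  simp only [e] at this
  exact this

theorem rqm_eq_separatedRQM {s : Sgn} {n : ℕ} {q : ℝ} (hq : 0 < q) {φ' ψ' : ℝ → ℝ}
    (hφ : ∀ x, HasDerivAt (angular s n q) (φ' x) x)
    (hψ : ∀ x, HasDerivAt (radial s n q) (ψ' x) x) :
    rqm s n (2 * √q) = separatedRQM (2 * √q) (angular s n q) φ' (radial s n q) ψ' := by
  funext p
  have hl : (2 * √q) ^ 2 / 4 = q := by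
    rw [mul_pow, Real.sq_sqrt hq.le]
    ring
  have hl0 : 2 * √q ≠ 0 := by positivity
  have hz : zeta s n q = fun p => radial s n q p.1 * angular s n q p.2 := by
    funext p
    rw [zeta, if_pos hq]
  have d1 : deriv (fun ξ : ℝ => (((radial s n q ξ * angular s n q p.2 : ℝ)) : ℍ[ℝ])) p.1 =
      ((ψ' p.1 * angular s n q p.2 : ℝ) : ℍ[ℝ]) :=
    (hasDerivAt_quaternion_coe ((hψ p.1).mul_const _)).deriv
  have d2 : deriv (fun η : ℝ => (((radial s n q p.1 * angular s n q η : ℝ)) : ℍ[ℝ])) p.2 =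
      ((radial s n q p.1 * φ' p.2 : ℝ) : ℍ[ℝ]) :=
    (hasDerivAt_quaternion_coe ((hφ p.2).const_mul _)).deriv
  rw [rqm, hl, hz, ellD, d1, d2, separatedRQM]
  generalize 2 * √q = l at hl0
  ext <;> simp <;> field_simp <;> ring

/-- This is the squared length of the coefficient vector in `D`, hence the source of the conformal
cancellation. -/
theorem weight_sum_sq (x y : ℝ) :
    (Real.sinh x * Real.cos y) ^ 2 + (Real.cosh x * Real.sin y) ^ 2 =
      (Real.cosh (2 * x) - Real.cos (2 * y)) / 2 := by
  rw [Real.cosh_two_mul, Real.cos_two_mul, mul_pow, mul_pow, Real.cosh_sq, Real.sin_sq]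
  ring

theorem weight_ne_zero {x : ℝ} (hx : x ≠ 0) (y : ℝ) :
    Real.cosh (2 * x) - Real.cos (2 * y) ≠ 0 := by
  have h1 : 1 < Real.cosh (2 * x) := Real.one_lt_cosh.2 (by simpa using hx)
  have h2 := Real.cos_le_one (2 * y)
  linarith

/-- The pointwise inner product of two separated functions, in the form `ζ₁ ζ₂ w` plus the
conformally invariant `∇ζ₁ · ∇ζ₂`. -/
theorem re_star_separatedRQM_mul {l₁ l₂ : ℝ} {φ₁ φ₁' ψ₁ ψ₁' φ₂ φ₂' ψ₂ ψ₂' : ℝ → ℝ}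
    {p : ℝ × ℝ} (μ : ℝ) (hp : p.1 ≠ 0) :
    (star (separatedRQM l₁ φ₁ φ₁' ψ₁ ψ₁' p) * separatedRQM l₂ φ₂ φ₂' ψ₂ ψ₂' p).re *
        ellWeight μ p =
      μ ^ 2 / 2 * ((ψ₁ p.1 * ψ₂ p.1 * Real.cosh (2 * p.1)) * (φ₁ p.2 * φ₂ p.2) -
        (ψ₁ p.1 * ψ₂ p.1) * (φ₁ p.2 * φ₂ p.2 * Real.cos (2 * p.2))) +
      μ ^ 2 / (l₁ * l₂) * ((ψ₁' p.1 * ψ₂' p.1) * (φ₁ p.2 * φ₂ p.2) +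
        (ψ₁ p.1 * ψ₂ p.1) * (φ₁' p.2 * φ₂' p.2)) := by
  have hc := weight_ne_zero hp p.2
  have hw := weight_sum_sq p.1 p.2
  simp only [separatedRQM, ellWeight, Quaternion.re_mul]
  simp
  generalize Real.cosh (2 * p.1) = c at *
  generalize Real.cos (2 * p.2) = d at *
  generalize Real.sinh p.1 * Real.cos p.2 = u at *
  generalize Real.cosh p.1 * Real.sin p.2 = v at *
  -- With the difference `c - d` as a single variable `w`, only `w w⁻¹ = 1` and `(u² + v²) w⁻¹ =
  -- 1/2` are needed.
  obtain ⟨w, rfl⟩ : ∃ w, c = w + d := ⟨c - d, by ring⟩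
  simp only [add_sub_cancel_right] at *
  simp only [div_eq_mul_inv, mul_inv]
  have hw' : (u ^ 2 + v ^ 2) * w⁻¹ = 1 / 2 := by
    rw [hw]
    field_simp
  have hww : w * w⁻¹ = 1 := mul_inv_cancel₀ hc
  linear_combination (2 * μ ^ 2 * l₁⁻¹ * l₂⁻¹ * ((ψ₁' p.1 * ψ₂' p.1) * (φ₁ p.2 * φ₂ p.2) +
        (ψ₁ p.1 * ψ₂ p.1) * (φ₁' p.2 * φ₂' p.2))) * (hw' + (u ^ 2 + v ^ 2) * w⁻¹ * hww)

/-! ### Integration over the rectangle. -/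

theorem setIntegral_ellRect_mul {ξ₀ : ℝ} (f g : ℝ → ℝ) (h : 0 ≤ ξ₀) :
    (∫ p in ellRect ξ₀, f p.1 * g p.2) =
      (∫ x in (0 : ℝ)..ξ₀, f x) * ∫ y in (0 : ℝ)..(2 * Real.pi), g y := by
  rw [ellRect, Measure.volume_eq_prod, setIntegral_prod_mul, integral_Ico_eq_integral_Ioc,
    integral_Icc_eq_integral_Ioc, intervalIntegral.integral_of_le h,
    intervalIntegral.integral_of_le Real.two_pi_pos.le]

theorem integrableOn_ellRect {F : ℝ × ℝ → ℝ} (hF : Continuous F) (ξ₀ : ℝ) :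
    IntegrableOn F (ellRect ξ₀) :=
  (hF.continuousOn.integrableOn_compact (isCompact_Icc.prod isCompact_Icc)).mono_set
    (Set.prod_mono Set.Ico_subset_Icc_self subset_rfl)

/-- The coordinates degenerate only at the foci, which lie on the null line `ξ = 0`; discarding that
line makes the pointwise identity available almost everywhere. -/
theorem ae_fst_ne_zero (S : Set (ℝ × ℝ)) : ∀ᵐ p ∂(volume.restrict S), p.1 ≠ 0 := by
  refine ae_restrict_of_ae ?_
  have : ∀ᵐ x : ℝ, x ≠ 0 := Measure.ae_ne volume 0
  exact (Measure.quasiMeasurePreserving_fst (μ := volume) (ν := volume)).ae this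

namespace IsSeparated

variable {s t : Sgn} {q₁ q₂ a₁ a₂ : ℝ} {φ₁ φ₁' ψ₁ ψ₁' φ₂ φ₂' ψ₂ ψ₂' : ℝ → ℝ}

theorem ellInner_eq (h₁ : IsSeparated s q₁ a₁ φ₁ φ₁' ψ₁ ψ₁')
    (h₂ : IsSeparated t q₂ a₂ φ₂ φ₂' ψ₂ ψ₂') (l₁ l₂ : ℝ) {μ : ℝ} (hμ : 0 ≤ xiMu μ) :
    ellInner μ (separatedRQM l₁ φ₁ φ₁' ψ₁ ψ₁') (separatedRQM l₂ φ₂ φ₂' ψ₂ ψ₂') =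
      μ ^ 2 / 2 * ((∫ x in (0 : ℝ)..xiMu μ, ψ₁ x * ψ₂ x * Real.cosh (2 * x)) *
          (∫ x in (0 : ℝ)..(2 * Real.pi), φ₁ x * φ₂ x) -
        (∫ x in (0 : ℝ)..xiMu μ, ψ₁ x * ψ₂ x) *
          (∫ x in (0 : ℝ)..(2 * Real.pi), φ₁ x * φ₂ x * Real.cos (2 * x))) +
      μ ^ 2 / (l₁ * l₂) * ((∫ x in (0 : ℝ)..xiMu μ, ψ₁' x * ψ₂' x) *
          (∫ x in (0 : ℝ)..(2 * Real.pi), φ₁ x * φ₂ x) +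
        (∫ x in (0 : ℝ)..xiMu μ, ψ₁ x * ψ₂ x) *
          (∫ x in (0 : ℝ)..(2 * Real.pi), φ₁' x * φ₂' x)) := by
  have := h₁.continuous_ang
  have := h₁.continuous_ang'
  have := h₁.continuous_rad
  have := h₁.continuous_rad'
  have := h₂.continuous_ang
  have := h₂.continuous_ang'
  have := h₂.continuous_rad
  have := h₂.continuous_rad'
  rw [ellInner, integral_congr_ae ((ae_fst_ne_zero _).mono fun p hp =>
    re_star_separatedRQM_mul μ hp), integral_add (integrableOn_ellRect (by fun_prop) _)
    (integrableOn_ellRect (by fun_prop) _), integral_const_mul, integral_const_mul,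
    integral_sub (integrableOn_ellRect (by fun_prop) _) (integrableOn_ellRect (by fun_prop) _),
    integral_add (integrableOn_ellRect (by fun_prop) _) (integrableOn_ellRect (by fun_prop) _),
    ← setIntegral_ellRect_mul _ _ hμ, ← setIntegral_ellRect_mul _ _ hμ,
    ← setIntegral_ellRect_mul _ _ hμ, ← setIntegral_ellRect_mul _ _ hμ]

theorem memWeightedL2 (h : IsSeparated s q₁ a₁ φ₁ φ₁' ψ₁ ψ₁') (l μ : ℝ) :
    MemWeightedL2 μ (separatedRQM l φ₁ φ₁' ψ₁ ψ₁') := by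
  have := h.continuous_ang
  have := h.continuous_ang'
  have := h.continuous_rad
  have := h.continuous_rad'
  refine ⟨?_, ?_⟩
  · unfold separatedRQM
    refine AEStronglyMeasurable.fun_sub ?_ ?_
    · exact Continuous.aestronglyMeasurable (by fun_prop)
    · refine AEStronglyMeasurable.fun_smul ?_ ?_
      -- The scalar `2 / (l w)` may be discontinuous at the foci but is measurable.
      · exact Measurable.aestronglyMeasurable (by fun_prop)
      · exact Continuous.aestronglyMeasurable (by fun_prop)
  -- After multiplication by the weight, the squared norm agrees almost everywhere with this
  -- continuous function, so the singularity of `Dζ` at the foci is harmless.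
  · have hF : IntegrableOn (fun p : ℝ × ℝ =>
        μ ^ 2 / 2 * ((ψ₁ p.1 * ψ₁ p.1 * Real.cosh (2 * p.1)) * (φ₁ p.2 * φ₁ p.2) -
          (ψ₁ p.1 * ψ₁ p.1) * (φ₁ p.2 * φ₁ p.2 * Real.cos (2 * p.2))) +
        μ ^ 2 / (l * l) * ((ψ₁' p.1 * ψ₁' p.1) * (φ₁ p.2 * φ₁ p.2) +
          (ψ₁ p.1 * ψ₁ p.1) * (φ₁' p.2 * φ₁' p.2))) (ellRect (xiMu μ)) :=
      integrableOn_ellRect (by fun_prop) _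
    refine hF.congr ((ae_fst_ne_zero _).mono fun p hp => ?_)
    refine (re_star_separatedRQM_mul μ hp).symm.trans ?_
    simp only
    rw [Quaternion.star_mul_self, Quaternion.re_coe,
      Quaternion.normSq_eq_norm_mul_self, sq]

/-- Matches the iterated integral for `‖ζ‖²` with the first bracket of `ellInner_eq`, taking `k = μ²
/ 2`. -/
theorem integral_integral_sq (h : IsSeparated s q₁ a₁ φ₁ φ₁' ψ₁ ψ₁') (k ξ₀ : ℝ) :
    (∫ η in (0 : ℝ)..(2 * Real.pi), ∫ ξ in (0 : ℝ)..ξ₀,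
        (ψ₁ ξ * φ₁ η) ^ 2 * (k * (Real.cosh (2 * ξ) - Real.cos (2 * η)))) =
      k * ((∫ x in (0 : ℝ)..ξ₀, ψ₁ x * ψ₁ x * Real.cosh (2 * x)) *
          (∫ x in (0 : ℝ)..(2 * Real.pi), φ₁ x * φ₁ x) -
        (∫ x in (0 : ℝ)..ξ₀, ψ₁ x * ψ₁ x) *
          (∫ x in (0 : ℝ)..(2 * Real.pi), φ₁ x * φ₁ x * Real.cos (2 * x))) := by
  have := h.continuous_ang
  have := h.continuous_rad
  have inner (η : ℝ) : (∫ ξ in (0 : ℝ)..ξ₀,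
      (ψ₁ ξ * φ₁ η) ^ 2 * (k * (Real.cosh (2 * ξ) - Real.cos (2 * η)))) =
      k * (∫ x in (0 : ℝ)..ξ₀, ψ₁ x * ψ₁ x * Real.cosh (2 * x)) * (φ₁ η * φ₁ η) -
        k * (∫ x in (0 : ℝ)..ξ₀, ψ₁ x * ψ₁ x) * (φ₁ η * φ₁ η * Real.cos (2 * η)) := by
    rw [mul_assoc, mul_assoc, ← intervalIntegral.integral_mul_const,
      ← intervalIntegral.integral_mul_const, ← mul_sub, ← intervalIntegral.integral_sub
      (Continuous.intervalIntegrable (by fun_prop) _ _)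
      (Continuous.intervalIntegrable (by fun_prop) _ _), ← intervalIntegral.integral_const_mul]
    exact intervalIntegral.integral_congr fun x _ => by ring
  simp_rw [inner]
  rw [intervalIntegral.integral_sub (Continuous.intervalIntegrable (by fun_prop) _ _)
      (Continuous.intervalIntegrable (by fun_prop) _ _), intervalIntegral.integral_const_mul,
    intervalIntegral.integral_const_mul]
  ring

end IsSeparated

/-! ## The Mathieu functions and their zeros -/

/-- The index is read off from the number of smaller eigenvalues. -/
theorem IsMathieuCharacteristic.unique_index {s : Sgn} {n₁ n₂ : ℕ} {q a : ℝ}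
    (h₁ : IsMathieuCharacteristic s n₁ q a) (h₂ : IsMathieuCharacteristic s n₂ q a) :
    n₁ = n₂ := by
  have e₁ := h₁.2
  have e₂ := h₂.2
  cases s <;> exact Nat.cast_injective (R := ℕ∞) (e₁.symm.trans e₂)

/-- Unless `φ^±_n[q]` is the zero function, it is separated data for a Mathieu characteristic. -/
theorem exists_isSeparated (s : Sgn) (n : ℕ) (q : ℝ) :
    mathieuFun s n q = 0 ∨ ∃ a φ' ψ', IsMathieuCharacteristic s n q a ∧
      IsSeparated s q a (angular s n q) φ' (radial s n q) ψ' ∧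
      (∫ η in (0 : ℝ)..(2 * Real.pi), angular s n q η ^ 2) =
        (1 + if n = 0 then 1 else 0) * Real.pi := by
  by_cases h : ∃ φ : ℂ → ℂ, IsMathieuFunction s n q φ
  · right
    have hf : IsMathieuFunction s n q (mathieuFun s n q) := by
      rw [mathieuFun, dif_pos h]
      exact h.choose_spec
    obtain ⟨⟨a, ha, hE⟩, hn, -⟩ := hf
    obtain ⟨φ', ψ', hS⟩ := hE.isSeparated
    refine ⟨a, φ', ψ', ha, ?_, hn⟩
    cases s <;> exact hS
  · left
    rw [mathieuFun, dif_neg h]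

theorem radial_eq_zero {s : Sgn} {n : ℕ} {q : ℝ} (h : mathieuFun s n q = 0) :
    radial s n q = 0 := by
  funext ξ
  cases s <;> simp [radial, h]

theorem rqm_eq_zero {s : Sgn} {n : ℕ} {l : ℝ} (h : zeta s n (l ^ 2 / 4) = 0) :
    rqm s n l = 0 := by
  funext p
  simp [rqm, h, ellD]

theorem IsRadialZero.unique_index {s : Sgn} {n m₁ m₂ : ℕ} {ξ q : ℝ}
    (h₁ : IsRadialZero s n m₁ ξ q) (h₂ : IsRadialZero s n m₂ ξ q) : m₁ = m₂ :=
  Nat.cast_injective (R := ℕ∞) (h₁.2.2.symm.trans h₂.2.2)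

/-- The function `Z^±_{n,m}[μ]` and `ζ^±_{n,m}[μ]` both vanish identically, or the zero
`q^±_{n,m}` and the Mathieu function are what they should be. -/
theorem zeroRQM_cases (s : Sgn) (n m : ℕ) (μ : ℝ) :
    (zeroRQM s n m μ = 0 ∧ zetaZ s n m μ = 0 ∧
      (qZero s n m (xiMu μ) = 0 ∨ mathieuFun s n (qZero s n m (xiMu μ)) = 0)) ∨
    (IsRadialZero s n m (xiMu μ) (qZero s n m (xiMu μ)) ∧
      ∃ a φ' ψ', IsMathieuCharacteristic s n (qZero s n m (xiMu μ)) a ∧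
        IsSeparated s (qZero s n m (xiMu μ)) a (angular s n (qZero s n m (xiMu μ))) φ'
          (radial s n (qZero s n m (xiMu μ))) ψ' ∧
        (∫ η in (0 : ℝ)..(2 * Real.pi), angular s n (qZero s n m (xiMu μ)) η ^ 2) =
          (1 + if n = 0 then 1 else 0) * Real.pi ∧
        zeroRQM s n m μ = separatedRQM (2 * √(qZero s n m (xiMu μ)))
          (angular s n (qZero s n m (xiMu μ))) φ' (radial s n (qZero s n m (xiMu μ))) ψ') := by
  have hdeg (h : zeta s n (qZero s n m (xiMu μ)) = 0) (h0 : 0 ≤ qZero s n m (xiMu μ)) :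
      zeroRQM s n m μ = 0 ∧ zetaZ s n m μ = 0 := by
    refine ⟨rqm_eq_zero ?_, h⟩
    rwa [mul_pow, Real.sq_sqrt h0, show (2 : ℝ) ^ 2 * qZero s n m (xiMu μ) / 4 =
      qZero s n m (xiMu μ) by ring]
  by_cases h : ∃ q : ℝ, IsRadialZero s n m (xiMu μ) q
  · have hz : IsRadialZero s n m (xiMu μ) (qZero s n m (xiMu μ)) := by
      rw [qZero, dif_pos h]
      exact h.choose_spec
    rcases exists_isSeparated s n (qZero s n m (xiMu μ)) with h0 | ⟨a, φ', ψ', ha, hS, hn⟩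
    · left
      obtain ⟨h1, h2⟩ := hdeg (by funext p; simp [zeta, radial_eq_zero h0]) hz.1.le
      exact ⟨h1, h2, Or.inr h0⟩
    · exact Or.inr ⟨hz, a, φ', ψ', ha, hS, hn,
        rqm_eq_separatedRQM hz.1 hS.hasDerivAt_ang hS.hasDerivAt_rad⟩
  · left
    have h0 : qZero s n m (xiMu μ) = 0 := by rw [qZero, dif_neg h]
    obtain ⟨h1, h2⟩ := hdeg (by funext p; simp [zeta, h0]) h0.ge
    exact ⟨h1, h2, Or.inl h0⟩

theorem zeroRQM_orthogonal {μ : ℝ} (hμ : 0 ≤ xiMu μ) {s₁ s₂ : Sgn} {n₁ n₂ m₁ m₂ : ℕ}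
    (hne : (s₁, n₁, m₁) ≠ (s₂, n₂, m₂)) :
    ellInner μ (zeroRQM s₁ n₁ m₁ μ) (zeroRQM s₂ n₂ m₂ μ) = 0 := by
  rcases zeroRQM_cases s₁ n₁ m₁ μ with h | ⟨z₁, a₁, φ₁', ψ₁', c₁, S₁, -, e₁⟩
  · simp [ellInner, h.1]
  rcases zeroRQM_cases s₂ n₂ m₂ μ with h | ⟨z₂, a₂, φ₂', ψ₂', c₂, S₂, -, e₂⟩
  · simp [ellInner, h.1]
  rw [e₁, e₂, S₁.ellInner_eq S₂ _ _ hμ]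
  by_cases hs : s₁ = s₂
  · subst hs
    -- If both `q` and `a` coincided, counting eigenvalues would give equal `n`, and then counting
    -- zeros equal `m`.
    have key := S₁.orthogonal_of_ne S₂ z₁.2.1 z₂.2.1 fun hq ha => by
      rw [← hq] at c₂ z₂
      rw [← ha] at c₂
      obtain rfl := c₁.unique_index c₂
      obtain rfl := z₁.unique_index z₂
      exact hne rfl
    rw [key.1, key.2, mul_zero, mul_zero, add_zero]
  · obtain ⟨hA, hB, hA'⟩ := S₁.integral_ang_of_ne S₂ hs
    rw [hA, hB, hA']
    ring

end RQM

theorem mainTheorem3 (μ : ℝ) (hμ0 : 0 < μ) (hμ1 : μ < 1) :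
    (∀ (s : RQM.Sgn) (n m : ℕ), 1 ≤ m → RQM.MemWeightedL2 μ (RQM.zeroRQM s n m μ)) ∧
    (∀ (s₁ s₂ : RQM.Sgn) (n₁ n₂ m₁ m₂ : ℕ), 1 ≤ m₁ → 1 ≤ m₂ →
      (s₁, n₁, m₁) ≠ (s₂, n₂, m₂) →
      RQM.ellInner μ (RQM.zeroRQM s₁ n₁ m₁ μ) (RQM.zeroRQM s₂ n₂ m₂ μ) = 0) ∧
    (∀ (s : RQM.Sgn) (n m : ℕ), 1 ≤ m → ∀ q : ℝ, q = RQM.qZero s n m (RQM.xiMu μ) →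
      RQM.ellInner μ (RQM.zeroRQM s n m μ) (RQM.zeroRQM s n m μ) =
        (∫ η in (0 : ℝ)..(2 * Real.pi), ∫ ξ in (0 : ℝ)..(RQM.xiMu μ),
          RQM.zetaZ s n m μ (ξ, η) ^ 2 *
            (μ ^ 2 / 2 * (Real.cosh (2 * ξ) - Real.cos (2 * η)))) +
        μ ^ 2 / (4 * q) * ((1 + if n = 0 then 1 else 0) * Real.pi) *
          (∫ ξ in (0 : ℝ)..(RQM.xiMu μ), deriv (RQM.radial s n q) ξ ^ 2) +
        μ ^ 2 / (4 * q) *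
          (∫ η in (0 : ℝ)..(2 * Real.pi), deriv (RQM.angular s n q) η ^ 2) *
          (∫ ξ in (0 : ℝ)..(RQM.xiMu μ), RQM.radial s n q ξ ^ 2)) := by
  have hξ : 0 ≤ RQM.xiMu μ := (RQM.mul_cosh_xiMu hμ0 hμ1).1.le
  refine ⟨fun s n m _ => ?_, fun _ _ _ _ _ _ _ _ hne => RQM.zeroRQM_orthogonal hξ hne,
    fun s n m _ q hq => ?_⟩
  · rcases RQM.zeroRQM_cases s n m μ with h | ⟨-, a, φ', ψ', -, S, -, e⟩
    · rw [h.1]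
      exact ⟨aestronglyMeasurable_zero, by simp⟩
    · rw [e]
      exact S.memWeightedL2 _ μ
  · rcases RQM.zeroRQM_cases s n m μ with ⟨h1, h2, h3⟩ | ⟨z, a, φ', ψ', -, S, hn, e⟩
    · rw [← hq] at h3
      rcases h3 with h3 | h3
      -- Here `q = 0`, and both coefficients `μ² / (4 q)` are zero by the convention for division by
      -- zero.
      · simp [RQM.ellInner, h1, h2, h3]
      · have hd : deriv (0 : ℝ → ℝ) = 0 := by
          funext x
          exact deriv_const x (0 : ℝ)
        simp [RQM.ellInner, h1, h2, RQM.radial_eq_zero h3, hd]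
    -- What remains is to recognise `λ² = 4 q` and the normalization of `φ`, which supplies `(1 + δ)
    -- π`.
    · rw [e, S.ellInner_eq S _ _ hξ, ← S.integral_integral_sq]
      rw [← hq] at z S hn ⊢
      have hζ : RQM.zetaZ s n m μ = fun p => RQM.radial s n q p.1 * RQM.angular s n q p.2 := by
        funext p
        rw [RQM.zetaZ, ← hq, RQM.zeta, if_pos z.1]
      rw [hζ, funext fun x => (S.hasDerivAt_ang x).deriv,
        funext fun x => (S.hasDerivAt_rad x).deriv, ← hn,
        show 2 * √q * (2 * √q) = 4 * q by nlinarith [Real.mul_self_sqrt z.1.le]]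
      simp only [sq]
      ring
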